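/- Let $\mathbb{F}$ be a field, $X=(x_{i,j})$ an $n\times m$ matrix of variables, and let $I^{\det}_{n,m,r}\subseteq\mathbb{F}[X]$ be the ideal generated by the $r\times r$ minors of $X$. Let $\varepsilon$ be an indeterminate. For a polynomial $P$ with coefficients in $\mathbb{F}((\varepsilon))$ and a polynomial $f$ over $\mathbb{F}$ in the same variables, write $P=f+O(\varepsilon)$ if $P=f+\varepsilon e$ for a polynomial $e$ with coefficients in $\mathbb{F}[[\varepsilon]]$. A layered algebraic branching program (ABP) over a field $K$ is a directed graph whose vertices are arranged in layers, with edges only from one layer to the next, labelled by affine linear polynomials over $K$, with a source in the first layer and a sink in the last layer. It computes the sum over all source–sink paths of the product of the edge labels. A polynomial $g\in\mathbb{F}[\vec y]$ is in the border of layered ABPs with at most $r$ vertices if some layered ABP over $\mathbb{F}((\varepsilon))$ with at most $r$ vertices computes a polynomial $g+O(\varepsilon)$. Let $f\in I^{\det}_{n,m,r}$ be nonzero, let $h(X,\varepsilon)\in\mathbb{F}[[\varepsilon]][X]$ be any polynomial with $h(X,\varepsilon)=f(X)+O(\varepsilon)$, and let $g(\vec y)\in\mathbb{F}[\vec y]$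 be in the border of layered ABPs with at most $r$ vertices. Then there are an integer $N\ge 1$ and a layered depth-three circuit $\Phi$ in the variables $\vec y$, with constants in $\mathbb{F}(\varepsilon)$ and with oracle gates that compute $h(X,\varepsilon^N)$, such that the following hold. 1. The gates of $\Phi$ are exactly $nm$ addition gates in the bottom layer, a single oracle gate in the middle layer, and a single addition gate (the output) in the top layer. Here an addition gate computes an arbitrary affine $\mathbb{F}(\varepsilon)$-linear combination of its inputs. 2. If $\operatorname{char}\mathbb{F}=0$, then $\Phi$ computes $g(\vec y)+O(\varepsilon)$. 3. If $\operatorname{char}\mathbb{F}=p>0$, then $\Phi$ computes $g(\vec y)^{p^k}+O(\varepsilon)$ for some $k\in\mathbb{N}$. -/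

import Mathlib

open scoped PowerSeries LaurentSeries RatFunc

/-! ### Determinantal ideals -/

/-- The ideal of `F[X]`, `X` the generic `n × m` matrix, generated by the `r × r` minors of `X`.
A minor is given by a choice of `r` rows and `r` columns in increasing order. -/
noncomputable def detIdeal (F : Type*) [Field F] (n m r : ℕ) :
    Ideal (MvPolynomial (Fin n × Fin m) F) :=
  Ideal.span {d | ∃ (R : Fin r ↪o Fin n) (C : Fin r ↪o Fin m),
    d = ((Matrix.mvPolynomialX (Fin n) (Fin m) F).submatrix R C).det}

/-! ### Border computation; the indeterminate `ε` is `PowerSeries.X` -/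

/-- `H = f + O(ε)` for `H ∈ F⟦ε⟧[x]` and `f ∈ F[x]`, that is, `H = f + ε e` with
`e ∈ F⟦ε⟧[x]`. -/
def IsApprox {F σ : Type*} [Field F] (H : MvPolynomial σ F⟦X⟧) (f : MvPolynomial σ F) : Prop :=
  ∃ e : MvPolynomial σ F⟦X⟧,
    H = MvPolynomial.map (PowerSeries.C (R := F)) f + MvPolynomial.C PowerSeries.X * e

/-- `P = f + O(ε)` for `P ∈ F((ε))[x]`: the polynomial `P` has all its coefficients in `F⟦ε⟧`,
and it equals `f + O(ε)` there. -/
def BorderComputes {F σ : Type*} [Field F] (P : MvPolynomial σ F⸨X⸩) (f : MvPolynomial σ F) :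
    Prop :=
  ∃ H : MvPolynomial σ F⟦X⟧, P = MvPolynomial.map (HahnSeries.ofPowerSeries ℤ F) H ∧ IsApprox H f

/-- The polynomial `h(x, ε ^ N)` obtained from `h(x, ε) ∈ F⟦ε⟧[x]`. -/
noncomputable def substEpsPow {F σ : Type*} [Field F] (N : ℕ) (hN : N ≠ 0)
    (h : MvPolynomial σ F⟦X⟧) : MvPolynomial σ F⟦X⟧ :=
  MvPolynomial.map (PowerSeries.expand N hN : F⟦X⟧ →ₐ[F] F⟦X⟧).toRingHom h

/-! ### Layered algebraic branching programs -/

/-- A layered algebraic branching program over `K` in the variables `σ` with `s` vertices.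
The vertices are arranged in layers `0, …, depth`; the source is in the first layer and the sink
is in the last one. The label of the edge from `u` to `v` is an affine linear polynomial, and the
label `0` means that there is no edge. Edges go from each layer to the next one. -/
structure LayeredABP (K σ : Type*) [Field K] (s : ℕ) where
  depth : ℕ
  layer : Fin s → Fin (depth + 1)
  source : Fin s
  sink : Fin s
  layer_source : layer source = 0
  layer_sink : layer sink = Fin.last depth
  label : Fin s → Fin s → MvPolynomial σ K
  label_affine : ∀ u v, (label u v).totalDegree ≤ 1
  label_layer : ∀ u v, label u v ≠ 0 → (layer v : ℕ) = layer u + 1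

open Classical in
/-- The polynomial computed by a layered algebraic branching program: the sum over all paths from
the source to the sink of the product of the edge labels. By the layering every such path has
exactly `depth` edges, and vertex sequences that are not paths contribute `0`. -/
noncomputable def LayeredABP.poly {K σ : Type*} [Field K] {s : ℕ} (B : LayeredABP K σ s) :
    MvPolynomial σ K :=
  ∑ p : Fin (B.depth + 1) → Fin s,
    if p 0 = B.source ∧ p (Fin.last B.depth) = B.sink then
      ∏ i : Fin B.depth, B.label (p i.castSucc) (p i.succ)
    else 0

/-- The polynomials in the border of layered algebraic branching programs with at most `r`
vertices. -/
def borderABP (F σ : Type*) [Field F] (r : ℕ) : Set (MvPolynomial σ F) :=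
  {g | ∃ s ≤ r, ∃ B : LayeredABP F⸨X⸩ σ s, BorderComputes B.poly g}

/-! ### Oracle circuits -/

/-- A gate of an oracle circuit over `K`, whose oracle polynomial has the variables `κ`, and which
may read the wires `W`. Scalars on the wires into an addition gate are free. -/
inductive OracleGate (K κ W : Type*) where
  /-- `c + ∑ w ∈ S, a w * w` -/
  | add (c : K) (S : Finset W) (a : W → K)
  /-- the product of the wires in `S` -/
  | mul (S : Multiset W)
  /-- the oracle polynomial evaluated at `args` -/
  | oracle (args : κ → W)

namespace OracleGate

variable {K κ W : Type*}

def IsAdd : OracleGate K κ W → Prop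
  | add _ _ _ => True
  | mul _ => False
  | oracle _ => False

def IsOracle : OracleGate K κ W → Prop
  | add _ _ _ => False
  | mul _ => False
  | oracle _ => True

/-- The wires that a gate reads. -/
def inputs : OracleGate K κ W → Set W
  | add _ S _ => {w | w ∈ S}
  | mul S => {w | w ∈ S}
  | oracle args => Set.range args

/-- The level of a gate is one more than the largest level of the wires that it reads. -/
def level [Fintype κ] (lev : W → ℕ) : OracleGate K κ W → ℕ
  | add _ S _ => S.sup lev + 1
  | mul S => (S.map lev).sup + 1
  | oracle args => (Finset.univ.sup fun k => lev (args k)) + 1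

/-- The polynomial computed at a gate, if `val w` is the polynomial on the wire `w` and `h` is the
oracle polynomial. Both may have coefficients in an extension `L` of the field of constants. -/
noncomputable def value {L σ : Type*} [Field K] [Field L] [Algebra K L] (h : MvPolynomial κ L)
    (val : W → MvPolynomial σ L) : OracleGate K κ W → MvPolynomial σ L
  | add c S a =>
      MvPolynomial.C (algebraMap K L c) + ∑ w ∈ S, MvPolynomial.C (algebraMap K L (a w)) * val w
  | mul S => (S.map val).prod
  | oracle args => MvPolynomial.bind₁ (fun k => val (args k)) h

end OracleGate

/-- An algebraic circuit over `K` in the variables `σ` with oracle gates for a polynomial in the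
variables `κ`. The gates are listed in a topological order: gate `i` may read the variables and the
gates before it. -/
structure OracleCircuit (K σ κ : Type*) where
  size : ℕ
  gate : (i : Fin size) → OracleGate K κ (σ ⊕ Fin (i : ℕ))
  output : Fin size

namespace OracleCircuit

variable {K σ κ : Type*}

/-- The polynomial computed at gate `i` if the oracle gates compute `h`. -/
noncomputable def gateValue {L : Type*} [Field K] [Field L] [Algebra K L]
    (Φ : OracleCircuit K σ κ) (h : MvPolynomial κ L) (i : Fin Φ.size) : MvPolynomial σ L :=
  (Φ.gate i).value h
    (Sum.elim MvPolynomial.X fun j : Fin (i : ℕ) => Φ.gateValue h ⟨j, j.2.trans i.2⟩)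
termination_by (i : ℕ)
decreasing_by exact j.2

/-- The polynomial computed by the circuit if the oracle gates compute `h`. -/
noncomputable def poly {L : Type*} [Field K] [Field L] [Algebra K L]
    (Φ : OracleCircuit K σ κ) (h : MvPolynomial κ L) : MvPolynomial σ L :=
  Φ.gateValue h Φ.output

/-- The level of gate `i`: the length of a longest path that ends in it. Variables have
level `0`. -/
def gateLevel [Fintype κ] (Φ : OracleCircuit K σ κ) (i : Fin Φ.size) : ℕ :=
  (Φ.gate i).level (Sum.elim (fun _ => 0) fun j : Fin (i : ℕ) => Φ.gateLevel ⟨j, j.2.trans i.2⟩)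
termination_by (i : ℕ)
decreasing_by exact j.2

/-- The level of a wire into gate `i`. -/
def wireLevel [Fintype κ] (Φ : OracleCircuit K σ κ) (i : Fin Φ.size) :
    σ ⊕ Fin (i : ℕ) → ℕ :=
  Sum.elim (fun _ => 0) fun j : Fin (i : ℕ) => Φ.gateLevel ⟨j, j.2.trans i.2⟩

/-- The depth of the circuit: the level of its output gate. -/
def depth [Fintype κ] (Φ : OracleCircuit K σ κ) : ℕ := Φ.gateLevel Φ.output

/-- Every wire goes from one level to the next one. -/
def IsLayered [Fintype κ] (Φ : OracleCircuit K σ κ) : Prop :=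
  ∀ i, ∀ w ∈ (Φ.gate i).inputs, Φ.wireLevel i w + 1 = Φ.gateLevel i

/-- The addition gates in layer `l`. -/
def addGates [Fintype κ] (Φ : OracleCircuit K σ κ) (l : ℕ) : Set (Fin Φ.size) :=
  {i | (Φ.gate i).IsAdd ∧ Φ.gateLevel i = l}

/-- The oracle gates in layer `l`. -/
def oracleGates [Fintype κ] (Φ : OracleCircuit K σ κ) (l : ℕ) : Set (Fin Φ.size) :=
  {i | (Φ.gate i).IsOracle ∧ Φ.gateLevel i = l}

/-- A layered depth-three circuit whose gates are exactly: `b` addition gates in the bottom layer,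
one oracle gate in the middle layer, and one addition gate (the output) in the top layer. -/
def IsSumOracleSum [Fintype κ] (Φ : OracleCircuit K σ κ) (b : ℕ) : Prop :=
  Φ.IsLayered ∧ Φ.depth = 3 ∧ Φ.size = b + 2 ∧
    (Φ.addGates 1).ncard = b ∧ (Φ.oracleGates 2).ncard = 1 ∧ (Φ.addGates 3).ncard = 1

end OracleCircuit

/-! The oracle is evaluated at a matrix of affine forms on which `f` is, to leading order in `ε`, a
power of `1 + ε g'`, where `g'` is the polynomial over `F⟦ε⟧` computed by the program.

Write `f (A diag(d) B)` as a polynomial in `d` with coefficients in the entries of generic `A`, `B`.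
It is nonzero, and since `f` kills matrices of rank below `r`, each of its monomials involves at
least `r` of the `d i`. Give `d i` the weight `b ^ i`, with `b` above all exponents. Distinct
monomials then have distinct weights, so at `d i = ε ^ (2 G b ^ i)` a single monomial `α₀`
dominates. Its largest variable has an index `p` with `r ≤ p + 1`, which leaves room to place the
program with its sink at position `p` (`LayeredABP.exists_strictly_upper`).

The program, closed by an edge from sink to source and rescaled, becomes an affine matrix `V = L
diag(e) U`, with `L` and `U` close to the identity and `e` equal to the above powers of `ε`, except
for an extra factor `1 + ε g'` at `p` (`exists_affine_factorization`). Hence `f (A₀ V B₀)` is `ε ^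
wt γ₀ (1 + ε g') ^ α₀ p` up to higher order. Because `α₀ p ≠ 0`, its first nonconstant term is a
multiple of `g' ^ q ^ a`, with `q` the characteristic exponent; this accounts for the Frobenius
power. The output gate subtracts the constant and rescales. A large `N` makes both the difference
between `h(X, ε ^ N)` and `f` and the truncation of the affine forms to `F[ε]` negligible. -/

/-! ### Vanishing on matrices of low rank. -/

open scoped Matrix in
/-- A product of matrices that factors through fewer than `r` indices has determinant zero. -/
theorem Matrix.det_mul_eq_zero_of_card_lt {S J : Type*} [CommRing S] [IsDomain S] [Fintype J]
    {r : ℕ} (hJ : Fintype.card J < r) (A : Matrix (Fin r) J S) (B : Matrix J (Fin r) S) :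
    (A * B).det = 0 := by
  rw [← Matrix.exists_vecMul_eq_zero_iff]
  by_contra! hv
  -- A row vector killed by `A` is killed by `A * B`, so without a left kernel of the product, rank
  -- `r` would embed into rank `card J < r`.
  have hinj : Function.Injective (Matrix.vecMulLinear A) := by
    rw [injective_iff_map_eq_zero]
    intro v h0
    by_contra hne
    refine hv v hne ?_
    rw [← Matrix.vecMul_vecMul]
    have : v ᵥ* A = 0 := h0
    rw [this, Matrix.zero_vecMul]
  have := LinearMap.finrank_le_finrank_of_injective hinj
  simp only [Module.finrank_fintype_fun_eq_card, Fintype.card_fin] at this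
  omega

/-- Elements of the determinantal ideal vanish on matrices `A diag(d) B` for which `d` has fewer
than `r` nonzero entries. -/
theorem aeval_eq_zero_of_mem_detIdeal {F S : Type*} [Field F] [CommRing S] [IsDomain S]
    [Algebra F S] {n m r : ℕ} {f : MvPolynomial (Fin n × Fin m) F} (hf : f ∈ detIdeal F n m r)
    (A : Matrix (Fin n) (Fin n) S) (B : Matrix (Fin n) (Fin m) S) (d : Fin n → S)
    (J : Finset (Fin n)) (hJ : J.card < r) (hd : ∀ i ∉ J, d i = 0) :
    MvPolynomial.aeval (fun x => (A * Matrix.diagonal d * B) x.1 x.2) f = 0 := by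
  suffices h : detIdeal F n m r ≤ RingHom.ker
      (MvPolynomial.aeval (R := F) fun x : Fin n × Fin m => (A * Matrix.diagonal d * B) x.1 x.2) from
    h hf
  refine Ideal.span_le.2 ?_
  rintro _ ⟨R, C, rfl⟩
  simp only [SetLike.mem_coe, RingHom.mem_ker]
  rw [AlgHom.map_det]
  have : (MvPolynomial.aeval (R := F)
      fun x : Fin n × Fin m => (A * Matrix.diagonal d * B) x.1 x.2).mapMatrix
        ((Matrix.mvPolynomialX (Fin n) (Fin m) F).submatrix R C) =
      (Matrix.of fun i (j : J) => A (R i) j * d j) * (Matrix.of fun (j : J) k => B j (C k)) := by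
    ext i k
    have h1 : (A * Matrix.diagonal d * B) (R i) (C k) = ∑ j, A (R i) j * d j * B j (C k) := by
      rw [Matrix.mul_apply]
      exact Finset.sum_congr rfl fun j _ => by rw [Matrix.mul_diagonal]
    rw [AlgHom.mapMatrix_apply, Matrix.map_apply, Matrix.submatrix_apply,
      Matrix.mvPolynomialX_apply, MvPolynomial.aeval_X, h1]
    refine Eq.trans ?_ (Finset.sum_coe_sort J (fun j => A (R i) j * d j * B j (C k))).symm
    symm
    refine Finset.sum_subset (Finset.subset_univ _) fun j _ hj => ?_
    rw [hd j hj]; simp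
  rw [this]
  exact Matrix.det_mul_eq_zero_of_card_lt (by simpa using hJ) _ _

/-! ### Congruences, clearing powers of `ε`, and affine polynomials. -/

/-- Congruent points have congruent values. -/
theorem MvPolynomial.eval₂_sub_eval₂_mem {R S τ : Type*} [CommRing R] [CommRing S] (φ : R →+* S)
    (I : Ideal S) {x y : τ → S} (h : ∀ i, x i - y i ∈ I) (c : MvPolynomial τ R) :
    MvPolynomial.eval₂ φ x c - MvPolynomial.eval₂ φ y c ∈ I := by
  rw [← Ideal.Quotient.mk_eq_mk_iff_sub_mem, MvPolynomial.hom_eval₂, MvPolynomial.hom_eval₂]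
  congr 1
  funext i
  exact (Ideal.Quotient.mk_eq_mk_iff_sub_mem _ _).2 (h i)

theorem LaurentSeries.exists_X_pow_mul {F : Type*} [Field F] (a : F⸨X⸩) :
    ∃ (D : ℕ) (b : F⟦X⟧), HahnSeries.ofPowerSeries ℤ F b =
      HahnSeries.ofPowerSeries ℤ F PowerSeries.X ^ D * a := by
  obtain ⟨⟨b, ⟨_, D, rfl⟩⟩, h⟩ :=
    IsLocalization.surj (Submonoid.powers (PowerSeries.X : F⟦X⟧)) a
  refine ⟨D, b, ?_⟩
  simp only [LaurentSeries.coe_algebraMap, map_pow] at h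
  rw [← h, mul_comm]

/-- A polynomial over `F((ε))` times a large power of `ε` has coefficients in `F⟦ε⟧`. -/
theorem MvPolynomial.exists_C_X_pow_mul {F σ : Type*} [Field F] (P : MvPolynomial σ F⸨X⸩) :
    ∃ D : ℕ, ∀ G ≥ D, ∃ Q : MvPolynomial σ F⟦X⟧,
      MvPolynomial.map (HahnSeries.ofPowerSeries ℤ F) Q =
        MvPolynomial.C (HahnSeries.ofPowerSeries ℤ F PowerSeries.X) ^ G * P := by
  suffices h : ∃ D : ℕ, ∃ Q : MvPolynomial σ F⟦X⟧,
      MvPolynomial.map (HahnSeries.ofPowerSeries ℤ F) Q =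
        MvPolynomial.C (HahnSeries.ofPowerSeries ℤ F PowerSeries.X) ^ D * P by
    obtain ⟨D, Q, h⟩ := h
    refine ⟨D, fun G hG => ⟨MvPolynomial.C PowerSeries.X ^ (G - D) * Q, ?_⟩⟩
    obtain ⟨e, rfl⟩ := Nat.exists_eq_add_of_le hG
    simp only [map_mul, map_pow, MvPolynomial.map_C, h, Nat.add_sub_cancel_left]
    ring
  induction P using MvPolynomial.induction_on with
  | C a =>
    obtain ⟨D, b, h⟩ := LaurentSeries.exists_X_pow_mul a
    exact ⟨D, MvPolynomial.C b, by rw [MvPolynomial.map_C, h, map_mul, map_pow]⟩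
  | add P Q hP hQ =>
    obtain ⟨D, P', h⟩ := hP
    obtain ⟨E, Q', h'⟩ := hQ
    refine ⟨D + E, MvPolynomial.C PowerSeries.X ^ E * P' + MvPolynomial.C PowerSeries.X ^ D * Q',
      ?_⟩
    simp only [map_add, map_mul, map_pow, MvPolynomial.map_C, h, h']
    ring
  | mul_X P i hP =>
    obtain ⟨D, P', h⟩ := hP
    exact ⟨D, P' * MvPolynomial.X i, by simp only [map_mul, h, MvPolynomial.map_X]; ring⟩

theorem MvPolynomial.exists_C_X_pow_mul_of_finite {F σ ι : Type*} [Field F] [Finite ι]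
    (P : ι → MvPolynomial σ F⸨X⸩) :
    ∃ D : ℕ, ∃ Q : ι → MvPolynomial σ F⟦X⟧, ∀ i,
      MvPolynomial.map (HahnSeries.ofPowerSeries ℤ F) (Q i) =
        MvPolynomial.C (HahnSeries.ofPowerSeries ℤ F PowerSeries.X) ^ D * P i := by
  have := Fintype.ofFinite ι
  choose D hD using fun i => MvPolynomial.exists_C_X_pow_mul (P i)
  choose Q hQ using fun i => hD i (Finset.univ.sup D) (Finset.le_sup (Finset.mem_univ i))
  exact ⟨_, Q, hQ⟩

/-- An affine linear polynomial in terms of its coefficients. -/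
theorem MvPolynomial.eq_of_totalDegree_le_one {R σ : Type*} [CommSemiring R] [Fintype σ]
    {P : MvPolynomial σ R} (hP : P.totalDegree ≤ 1) :
    P = MvPolynomial.C (P.coeff 0) +
      ∑ i, MvPolynomial.C (P.coeff (Finsupp.single i 1)) * MvPolynomial.X i := by
  classical
  ext α
  simp only [MvPolynomial.coeff_add, MvPolynomial.coeff_C, MvPolynomial.coeff_sum,
    MvPolynomial.coeff_C_mul, MvPolynomial.coeff_X]
  by_cases h0 : α = 0
  · subst h0
    simp
  by_cases h1 : ∃ i, α = Finsupp.single i 1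
  · obtain ⟨i, rfl⟩ := h1
    simp [Finsupp.single_left_inj, eq_comm]
  · push Not at h1
    rw [if_neg (Ne.symm h0), zero_add]
    rw [Finset.sum_eq_zero fun i _ => by rw [if_neg (Ne.symm (h1 i)), mul_zero]]
    by_contra hne
    have h2 := (MvPolynomial.le_totalDegree (MvPolynomial.mem_support_iff.2 hne)).trans hP
    have h3 : α.degree = 1 := by
      have : α.degree ≠ 0 := by rwa [Ne, Finsupp.degree_eq_zero_iff]
      have h4 : α.degree = α.sum fun _ e => e := rfl
      omega
    obtain ⟨i, hi⟩ : ∃ i, α i ≠ 0 := by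
      by_contra! h4
      exact h0 (Finsupp.ext h4)
    refine h1 i (Finsupp.ext fun j => ?_)
    have h5 : α.degree = α i + ∑ j ∈ Finset.univ.erase i, α j := by
      rw [Finset.add_sum_erase _ _ (Finset.mem_univ i), Finsupp.degree_eq_sum]
    have h6 : ∑ j ∈ Finset.univ.erase i, α j = 0 := by omega
    by_cases hij : j = i
    · subst hij
      simp only [Finsupp.single_eq_same]
      omega
    · rw [Finsupp.single_eq_of_ne hij]
      exact Finset.sum_eq_zero_iff.1 h6 j (by simp [hij])

/-! ### Unique weights and powers of `1 + x`. -/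

/-- Digit expansions to the base `b` are unique. -/
theorem sum_pow_mul_injective {n b : ℕ} (hb : 1 < b) {v w : Fin n → ℕ} (hv : ∀ i, v i < b)
    (hw : ∀ i, w i < b)
    (h : ∑ i : Fin n, b ^ (i : ℕ) * v i = ∑ i : Fin n, b ^ (i : ℕ) * w i) : v = w := by
  refine List.ofFn_injective (Nat.ofDigits_inj_of_len_eq hb (by simp) ?_ ?_ ?_)
  · simpa [List.mem_ofFn] using hv
  · simpa [List.mem_ofFn] using hw
  · simp only [Nat.ofDigits_eq_sum_mapIdx, List.mapIdx_eq_ofFn, List.get_ofFn, List.length_ofFn,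
      Fin.val_cast, List.sum_ofFn]
    simp only [mul_comm (b ^ _)] at h
    exact h

/-- In characteristic exponent `q`, some power `q ^ a` controls the first nontrivial term of
`(1 + x) ^ k`. -/
theorem exists_one_add_pow_eq {F S : Type*} [Field F] [CommRing S] [Algebra F S] (q : ℕ)
    [ExpChar F q] {k : ℕ} (hk : k ≠ 0) :
    ∃ (a k' : ℕ), (k' : F) ≠ 0 ∧ ∀ x : S, ∃ z : S,
      (1 + x) ^ k = 1 + (k' : S) * x ^ q ^ a + x ^ (2 * q ^ a) * z := by
  obtain ⟨a, k', hk', rfl⟩ : ∃ a k' : ℕ, (k' : F) ≠ 0 ∧ k = q ^ a * k' := by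
    rcases ‹ExpChar F q› with _ | hp
    · exact ⟨0, k, by exact_mod_cast hk, by simp⟩
    · obtain ⟨a, k', h, rfl⟩ := Nat.exists_eq_pow_mul_and_not_dvd hk q hp.ne_one
      exact ⟨a, k', by rwa [Ne, CharP.cast_eq_zero_iff F q], rfl⟩
  refine ⟨a, k', hk', fun x => ?_⟩
  rcases subsingleton_or_nontrivial S with hS | hS
  · exact ⟨0, Subsingleton.elim _ _⟩
  have := expChar_of_injective_algebraMap (algebraMap F S).injective q
  obtain ⟨z, hz⟩ := Polynomial.powAddExpansion (1 : S) (x ^ q ^ a) k'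
  refine ⟨z, ?_⟩
  -- Frobenius turns `(1 + x) ^ q ^ a` into `1 + x ^ q ^ a`; the part `k'` prime to the
  -- characteristic then leaves an invertible linear coefficient.
  rw [pow_mul, add_pow_expChar_pow, one_pow, hz]
  ring

/-! ### Branching programs as triangular matrices. -/

/-- The entries of a power of a matrix as sums over walks. -/
theorem Matrix.pow_apply_eq_sum_walks {R V : Type*} [CommSemiring R] [Fintype V] [DecidableEq V]
    (A : Matrix V V R) (d : ℕ) (u v : V) :
    (A ^ d) u v = ∑ p : Fin (d + 1) → V,
      if p 0 = u ∧ p (Fin.last d) = v then ∏ i : Fin d, A (p i.castSucc) (p i.succ) else 0 := by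
  induction d generalizing u with
  | zero =>
    rw [← (Equiv.funUnique (Fin 1) V).symm.sum_comp]
    simp only [pow_zero, Matrix.one_apply, Equiv.funUnique_symm_apply, uniqueElim_const,
      Finset.univ_eq_empty, Finset.prod_empty]
    by_cases h : u = v
    · subst h
      simp
    · rw [if_neg h, Finset.sum_eq_zero]
      intro x _
      rw [if_neg]
      rintro ⟨rfl, rfl⟩
      exact h rfl
  | succ d ih =>
    rw [pow_succ', Matrix.mul_apply, ← (Fin.consEquiv fun _ : Fin (d + 2) => V).sum_comp,
      Fintype.sum_prod_type]
    symm
    rw [Finset.sum_eq_single u]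
    · simp only [Fin.consEquiv_apply, Fin.cons_zero, true_and, ← Fin.succ_last, Fin.cons_succ,
        Fin.prod_univ_succ, Fin.castSucc_zero, ← Fin.succ_castSucc]
      simp only [ih, Finset.mul_sum]
      rw [Finset.sum_comm]
      refine Finset.sum_congr rfl fun p _ => ?_
      symm
      rw [Finset.sum_eq_single (p 0)]
      · simp
      · intro w _ hw
        simp [Ne.symm hw]
      · simp
    · intro w _ hw
      simp [hw]
    · simp

/-- Every layered algebraic branching program can be placed in strictly upper triangular form on
`Fin n`, with its sink at any position `p` that leaves room for the other vertices. The row `q`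
lists the sums over all paths from the source. -/
theorem LayeredABP.exists_strictly_upper {K σ : Type*} [Field K] {s n : ℕ} (B : LayeredABP K σ s)
    (p : Fin n) (hp : s ≤ p + 1) :
    ∃ (A : Matrix (Fin n) (Fin n) (MvPolynomial σ K)) (src : Fin n) (q : Fin n → MvPolynomial σ K),
      (∀ i j, A i j ≠ 0 → i < j) ∧ (∀ i j, (A i j).totalDegree ≤ 1) ∧
      Matrix.vecMul q (1 - A) = Pi.single src 1 ∧ q p = B.poly ∧ ∀ j, p < j → q j = 0 := by
  classical
  -- Sorting by this key is a topological order; the extra `1` puts the sink after the other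
  -- vertices of the last layer.
  let key : Fin s → ℕ := fun u => 2 * (B.layer u : ℕ) + if u = B.sink then 1 else 0
  let pos : Fin s → Fin s := (Tuple.sort key).symm
  have hpos_inj : Function.Injective pos := (Tuple.sort key).symm.injective
  have hpos : ∀ u v, key u < key v → pos u < pos v := by
    intro u v huv
    by_contra! h
    have := Tuple.monotone_sort key h
    simp [pos] at this
    omega
  have hsink : ∀ u, pos u ≤ pos B.sink := by
    intro u
    by_cases hu : u = B.sink
    · rw [hu]
    · refine (hpos _ _ ?_).le
      have h1 : (B.layer u : ℕ) ≤ B.depth := Nat.le_of_lt_succ (B.layer u).2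
      simp [key, hu, B.layer_sink]
      omega
  have hlast : (pos B.sink : ℕ) + 1 = s := by
    have hs : 0 < s := B.sink.pos
    obtain ⟨u, hu⟩ := (Tuple.sort key).symm.surjective ⟨s - 1, by omega⟩
    have h1 := hsink u
    have h2 : (pos u : ℕ) = s - 1 := by simp [pos, hu]
    have h3 : (pos u : ℕ) ≤ pos B.sink := h1
    have := (pos B.sink).2
    omega
  have hps := p.2
  -- The shift carries the last position `s - 1`, that of the sink, to `p`.
  let ι : Fin s → Fin n := fun u => ⟨pos u + (p + 1 - s), by have := (pos u).2; omega⟩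
  have hι_inj : Function.Injective ι := by
    intro u v huv
    apply hpos_inj
    have := congrArg Fin.val huv
    simp only [ι] at this
    exact Fin.ext (by omega)
  have hι_sink : ι B.sink = p := Fin.ext (by simp only [ι]; omega)
  have hι_le : ∀ u, ι u ≤ p := by
    intro u
    have h3 : (pos u : ℕ) ≤ pos B.sink := hsink u
    rw [← hι_sink, Fin.le_def]
    simp only [ι]
    omega
  let L : Matrix (Fin s) (Fin s) (MvPolynomial σ K) := Matrix.of B.label
  let P : Matrix (Fin s) (Fin n) (MvPolynomial σ K) := Matrix.of fun u i => if ι u = i then 1 else 0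
  have hPP : P * P.transpose = 1 := by
    ext u v : 1
    simp [P, Matrix.mul_apply, Matrix.one_apply, hι_inj.eq_iff, eq_comm]
  have hlayer : ∀ k u v, (L ^ k) u v ≠ 0 → (B.layer v : ℕ) = B.layer u + k := by
    intro k
    induction k with
    | zero =>
      intro u v h
      by_cases huv : u = v
      · simp [huv]
      · simp [huv] at h
    | succ k ih =>
      intro u v h
      rw [pow_succ, Matrix.mul_apply] at h
      obtain ⟨w, _, hw⟩ := Finset.exists_ne_zero_of_sum_ne_zero h
      have h1 := ih u w (left_ne_zero_of_mul hw)
      have h2 := B.label_layer w v (right_ne_zero_of_mul hw)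
      omega
  have hnil : L ^ (B.depth + 1) = 0 := by
    ext u v : 1
    by_contra h
    have := hlayer _ _ _ h
    have := (B.layer v).2
    omega
  -- The inverse of `1 - L` by nilpotency: its entries sum over walks of all lengths, and by the
  -- layering only length `depth` joins source to sink.
  let Q := ∑ k ∈ Finset.range (B.depth + 1), L ^ k
  have hQ : Q * (1 - L) = 1 := by simp [Q, geom_sum_mul_neg, hnil]
  have hQs : Q B.source B.sink = B.poly := by
    simp only [Q, Matrix.sum_apply]
    rw [Finset.sum_eq_single B.depth]
    · refine (Matrix.pow_apply_eq_sum_walks L B.depth B.source B.sink).trans ?_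
      unfold LayeredABP.poly
      refine Finset.sum_congr rfl fun w _ => ?_
      congr!
    · intro k _ hk
      by_contra h
      have := hlayer _ _ _ h
      rw [B.layer_source, B.layer_sink] at this
      simp at this
      omega
    · simp
  have hA : ∀ i j, (P.transpose * L * P) i j = ∑ u, ∑ v, if ι u = i ∧ ι v = j then B.label u v
      else 0 := by
    intro i j
    simp only [Matrix.mul_apply, Matrix.transpose_apply, P, L, Matrix.of_apply, Finset.sum_mul]
    rw [Finset.sum_comm]
    refine Finset.sum_congr rfl fun u _ => Finset.sum_congr rfl fun v _ => ?_
    by_cases h1 : ι u = i <;> by_cases h2 : ι v = j <;> simp [h1, h2]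
  have hq : ∀ j, (Q * P) B.source j = ∑ v, if ι v = j then Q B.source v else 0 := by
    intro j
    simp [Matrix.mul_apply, P]
  refine ⟨P.transpose * L * P, ι B.source, (Q * P) B.source, ?_, ?_, ?_, ?_, ?_⟩
  · intro i j h
    rw [hA] at h
    obtain ⟨u, _, hu⟩ := Finset.exists_ne_zero_of_sum_ne_zero h
    obtain ⟨v, _, hv⟩ := Finset.exists_ne_zero_of_sum_ne_zero hu
    split_ifs at hv with h1
    · rw [← h1.1, ← h1.2]
      have h2 := B.label_layer u v hv
      have h3 : pos u < pos v := by
        apply hpos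
        simp only [key]
        split_ifs <;> omega
      have h4 : (pos u : ℕ) < pos v := h3
      rw [Fin.lt_def]
      simp only [ι]
      omega
    · exact absurd rfl hv
  · intro i j
    rw [hA]
    refine MvPolynomial.totalDegree_finsetSum_le fun u _ =>
      MvPolynomial.totalDegree_finsetSum_le fun v _ => ?_
    split_ifs
    · exact B.label_affine u v
    · simp
  · have h1 : Q * P * (1 - P.transpose * L * P) = P := by
      calc Q * P * (1 - P.transpose * L * P)
          = Q * P - Q * (P * P.transpose) * L * P := by
            simp only [Matrix.mul_sub, Matrix.mul_one, Matrix.mul_assoc]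
        _ = Q * (1 - L) * P := by
            rw [hPP, Matrix.mul_one, Matrix.mul_sub, Matrix.mul_one, Matrix.sub_mul]
        _ = P := by rw [hQ, Matrix.one_mul]
    have h2 := congrFun h1 B.source
    rw [← Matrix.mul_apply_eq_vecMul] 
    rw [h2]
    funext j
    simp [P, Pi.single_apply, eq_comm]
  · rw [hq, ← hι_sink]
    simp [hι_inj.eq_iff, hQs]
  · intro j hj
    rw [hq]
    refine Finset.sum_eq_zero fun v _ => if_neg ?_
    rintro rfl
    exact absurd (hι_le v) (not_le.2 hj)

/-! ### Factorization of the closed-up program. -/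

theorem MvPolynomial.totalDegree_le_of_map_eq {R S σ : Type*} [CommSemiring R] [CommSemiring S]
    {φ : R →+* S} (hφ : Function.Injective φ) {P : MvPolynomial σ R} {Q : MvPolynomial σ S}
    (h : MvPolynomial.map φ P = Q) : P.totalDegree ≤ Q.totalDegree := by
  subst h
  rw [MvPolynomial.totalDegree, MvPolynomial.totalDegree,
    MvPolynomial.support_map_of_injective _ hφ]

theorem MvPolynomial.totalDegree_C_pow_mul_le {R σ : Type*} [CommSemiring R] (c : R) (k : ℕ)
    (P : MvPolynomial σ R) : (MvPolynomial.C c ^ k * P).totalDegree ≤ P.totalDegree := by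
  rw [← map_pow]
  exact (MvPolynomial.totalDegree_mul _ _).trans (by rw [MvPolynomial.totalDegree_C, zero_add])

/-- After scaling rows and columns by suitable powers of `ε`, the strictly upper triangular matrix
`A` of an algebraic branching program, closed up by an edge from its sink to its source, is a
diagonal matrix up to factors that are close to the identity. -/
theorem exists_affine_factorization {F σ : Type*} [Field F] {n b : ℕ} (hb : 2 ≤ b)
    (A : Matrix (Fin n) (Fin n) (MvPolynomial σ F⸨X⸩)) (p src : Fin n)
    (q : Fin n → MvPolynomial σ F⸨X⸩) (hA : ∀ i j, A i j ≠ 0 → i < j)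
    (hAdeg : ∀ i j, (A i j).totalDegree ≤ 1) (hqA : Matrix.vecMul q (1 - A) = Pi.single src 1)
    (hq : ∀ j, p < j → q j = 0) (g : MvPolynomial σ F⟦X⟧)
    (hg : MvPolynomial.map (HahnSeries.ofPowerSeries ℤ F) g = q p) (M : ℕ) :
    ∃ G ≥ M, ∃ L U V : Matrix (Fin n) (Fin n) (MvPolynomial σ F⟦X⟧),
      (∀ i j, MvPolynomial.C PowerSeries.X ^ M ∣ L i j - (1 : Matrix _ _ _) i j) ∧
      (∀ i j, MvPolynomial.C PowerSeries.X ^ M ∣ U i j - (1 : Matrix _ _ _) i j) ∧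
      V = L * Matrix.diagonal (fun i : Fin n =>
        MvPolynomial.C PowerSeries.X ^ (2 * (G * b ^ (i : ℕ))) *
        if i = p then 1 + MvPolynomial.C PowerSeries.X * g else 1) * U ∧
      ∀ i j, (V i j).totalDegree ≤ 1 := by
  obtain ⟨D, Q, hQ⟩ := MvPolynomial.exists_C_X_pow_mul_of_finite
    (Sum.elim (fun x : Fin n × Fin n => A x.1 x.2) q)
  have hQA : ∀ i j, _ = _ := fun i j => hQ (Sum.inl (i, j))
  have hQq : ∀ j, _ = _ := fun j => hQ (Sum.inr j)
  simp only [Sum.elim_inl] at hQA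
  simp only [Sum.elim_inr] at hQq
  have hφ : Function.Injective (HahnSeries.ofPowerSeries ℤ F) := HahnSeries.ofPowerSeries_injective
  set φ := HahnSeries.ofPowerSeries ℤ F with hφ_def
  have hinj := MvPolynomial.map_injective (σ := σ) φ hφ
  set ε : MvPolynomial σ F⟦X⟧ := MvPolynomial.C PowerSeries.X with hε
  set t : MvPolynomial σ F⸨X⸩ := MvPolynomial.C (φ PowerSeries.X) with ht
  have hεt : MvPolynomial.map φ ε = t := by simp only [hε, ht, MvPolynomial.map_C]
  -- Consecutive exponents `a i` differ by at least `G`: `D` of this clears the denominators of `A`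
  -- and `q`, and `M` remains as closeness to the identity.
  set G := D + M with hG
  let a : Fin n → ℕ := fun i => G * b ^ (i : ℕ)
  have ha : ∀ i j : Fin n, i < j → a i + D + M ≤ a j := by
    intro i j hij
    have h1 : b ^ ((i : ℕ) + 1) ≤ b ^ (j : ℕ) := Nat.pow_le_pow_right (by omega) hij
    have h2 : b ^ (i : ℕ) + 1 ≤ b ^ (j : ℕ) := by
      have h3 : 1 ≤ b ^ (i : ℕ) := Nat.one_le_pow _ _ (by omega)
      rw [pow_succ] at h1
      nlinarith
    calc a i + D + M = G * (b ^ (i : ℕ) + 1) := by simp only [a, hG]; ring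
      _ ≤ a j := Nat.mul_le_mul_left _ h2
  -- The conjugate of `A` by `diag(ε ^ a i)`. It is integral because `A` is strictly upper
  -- triangular; by `ha` the subtractions do not truncate.
  let A' : Matrix (Fin n) (Fin n) (MvPolynomial σ F⟦X⟧) := Matrix.of fun i j =>
    if i < j then ε ^ (a j - a i - D) * Q (Sum.inl (i, j)) else 0
  have hA' : ∀ i j, t ^ a i * MvPolynomial.map φ (A' i j) = t ^ a j * A i j := by
    intro i j
    simp only [A', Matrix.of_apply]
    split_ifs with hij
    · have := ha i j hij
      rw [map_mul, map_pow, hεt, hQA, ← mul_assoc, ← mul_assoc, ← pow_add, ← pow_add]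
      congr 2
      omega
    · have h0 : A i j = 0 := by
        by_contra h
        exact hij (hA i j h)
      simp [h0]
  have hA'deg : ∀ i j, (A' i j).totalDegree ≤ 1 := by
    intro i j
    simp only [A', Matrix.of_apply]
    split_ifs with hij
    · refine (MvPolynomial.totalDegree_C_pow_mul_le _ _ _).trans ?_
      exact (MvPolynomial.totalDegree_le_of_map_eq hφ (hQA i j)).trans
        ((MvPolynomial.totalDegree_C_pow_mul_le _ _ _).trans (hAdeg i j))
    · simp
  -- Represents `ε ^ (a p - a j + 1) * q j`. Entries with `p < j` would need negative powers of `ε`,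
  -- which is why `q` must vanish beyond the sink.
  let lam : Fin n → MvPolynomial σ F⟦X⟧ := fun j =>
    if j < p then ε ^ (a p - a j - D + 1) * Q (Sum.inr j) else 0
  let e : Fin n → MvPolynomial σ F⟦X⟧ := fun i =>
    ε ^ (2 * (G * b ^ (i : ℕ))) * if i = p then 1 + ε * g else 1
  -- The excess of row `p` of `L * diag(e)` over `diag(ε ^ (2 * a i))`. At `j = p` it comes from the
  -- factor `1 + ε * g`; altogether it is a rescaled copy of `q`.
  let rho : Fin n → MvPolynomial σ F⟦X⟧ := fun j =>
    lam j * e j + if j = p then ε ^ (2 * a p + 1) * g else 0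
  have hrho : ∀ j, MvPolynomial.map φ (rho j) = t ^ (a p + 1) * (t ^ a j * q j) := by
    intro j
    rcases lt_trichotomy j p with hj | hj | hj
    · have := ha j p hj
      simp only [rho, lam, e, if_pos hj, if_neg hj.ne, mul_one, add_zero, map_mul, map_pow, hεt,
        hQq]
      rw [← mul_assoc, ← mul_assoc, ← pow_add, mul_right_comm, ← pow_add,
        ← mul_assoc (t ^ (a p + 1)), ← pow_add]
      congr 2
      have h1 : 2 * G * b ^ (j : ℕ) = 2 * a j := mul_assoc _ _ _
      omega
    · subst hj
      simp only [rho, lam, lt_irrefl, if_true, if_false, zero_mul, zero_add, map_mul, map_pow, hεt,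
        hg]
      ring
    · simp [rho, lam, hj.ne', hj.not_gt, hq j hj]
  -- The rescaled form of `q (1 - A) = e_src`: the high-degree path sums collapse to one constant,
  -- the closing edge, so that the product is affine.
  have hrhoA : ∀ k, ∑ j, rho j * (1 - A') j k = if k = src then ε ^ (a p + a src + 1) else 0 := by
    intro k
    apply hinj
    have h1 : ∀ j, MvPolynomial.map φ (rho j * (1 - A') j k) =
        t ^ (a p + 1 + a k) * (q j * (1 - A) j k) := by
      intro j
      have h2 : t ^ a j * MvPolynomial.map φ ((1 - A') j k) = t ^ a k * (1 - A) j k := by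
        rw [Matrix.sub_apply, Matrix.sub_apply, map_sub, mul_sub, mul_sub, hA']
        congr 1
        by_cases hjk : j = k
        · rw [hjk, Matrix.one_apply_eq, Matrix.one_apply_eq, map_one]
        · rw [Matrix.one_apply_ne hjk, Matrix.one_apply_ne hjk, map_zero, mul_zero, mul_zero]
      rw [map_mul, hrho]
      calc _ = t ^ (a p + 1) * q j * (t ^ a j * MvPolynomial.map φ ((1 - A') j k)) := by ring
        _ = _ := by rw [h2]; ring
    rw [map_sum, Finset.sum_congr rfl fun j _ => h1 j, ← Finset.mul_sum]
    have h3 : ∑ j, q j * (1 - A) j k = (Pi.single src 1 : Fin n → MvPolynomial σ F⸨X⸩) k :=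
      congrFun hqA k
    rw [h3, Pi.single_apply]
    split_ifs with h
    · rw [h, map_pow, hεt]; ring
    · simp
  refine ⟨G, by omega, 1 + Matrix.of (fun i j => if i = p then lam j else 0), 1 - A',
    Matrix.diagonal (fun i => ε ^ (2 * a i)) * (1 - A') +
      Matrix.of (fun i j => if i = p then if j = src then ε ^ (a p + a src + 1) else 0 else 0),
    ?_, ?_, ?_, ?_⟩
  · intro i j
    simp only [Matrix.add_apply, add_sub_cancel_left, Matrix.of_apply, lam]
    split_ifs with h1 h2
    · have := ha j p h2
      exact (pow_dvd_pow _ (by omega)).mul_right _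
    · exact dvd_zero _
    · exact dvd_zero _
  · intro i j
    have hd : ε ^ M ∣ A' i j := by
      simp only [Matrix.of_apply, A']
      split_ifs with h1
      · have := ha i j h1
        exact (pow_dvd_pow _ (by omega)).mul_right _
      · exact dvd_zero _
    obtain ⟨c, hc⟩ := hd
    exact ⟨-c, by rw [Matrix.sub_apply, hc]; ring⟩
  · have h1 : (1 + Matrix.of (fun i j => if i = p then lam j else 0)) * Matrix.diagonal e =
        Matrix.diagonal (fun i => ε ^ (2 * a i)) +
          Matrix.of (fun i j => if i = p then rho j else 0) := by
      refine Matrix.ext fun i j => ?_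
      rw [Matrix.mul_diagonal, Matrix.add_apply, Matrix.add_apply, Matrix.of_apply,
        Matrix.of_apply, Matrix.one_apply, Matrix.diagonal_apply]
      simp only [rho, e]
      by_cases hi : i = p <;> by_cases hij : i = j
      · subst hi
        subst hij
        simp only [if_true, a]
        ring
      · have hjp : j ≠ p := fun h => hij (hi.trans h.symm)
        simp [hi, hjp]
        simp [← hi, hij]
      · subst hij
        simp [hi, a]
      · simp [hi, hij]
    rw [show (fun i : Fin n => ε ^ (2 * (G * b ^ (i : ℕ))) * if i = p then 1 + ε * g else 1) = e
      from rfl,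
      h1, Matrix.add_mul]
    congr 1
    refine Matrix.ext fun i k => ?_
    rw [Matrix.mul_apply]
    by_cases hi : i = p
    · simp only [Matrix.of_apply, if_pos hi]
      exact (hrhoA k).symm
    · simp [hi]
  · intro i j
    rw [Matrix.add_apply, Matrix.diagonal_mul, Matrix.of_apply]
    refine (MvPolynomial.totalDegree_add _ _).trans (max_le ?_ ?_)
    · refine (MvPolynomial.totalDegree_C_pow_mul_le _ _ _).trans ?_
      rw [Matrix.sub_apply]
      refine (MvPolynomial.totalDegree_sub _ _).trans (max_le ?_ (hA'deg i j))
      rw [Matrix.one_apply]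
      split_ifs <;> simp
    · split_ifs
      · rw [hε, ← map_pow, MvPolynomial.totalDegree_C]; exact zero_le_one
      · simp
      · simp

/-! ### The generic product and its monomials. -/

/-- The polynomial `f (A diag(d) B)` in the variables `d`, for generic matrices `A` and `B`. -/
noncomputable def genericProduct {F : Type*} [Field F] {n m : ℕ}
    (f : MvPolynomial (Fin n × Fin m) F) :
    MvPolynomial (Fin n) (MvPolynomial ((Fin n × Fin n) ⊕ (Fin n × Fin m)) F) :=
  MvPolynomial.aeval (fun x => ∑ k, MvPolynomial.C
    (MvPolynomial.X (Sum.inl (x.1, k)) * MvPolynomial.X (Sum.inr (k, x.2))) * MvPolynomial.X k) f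

theorem Matrix.mul_diagonal_mul_apply {S ι κ μ : Type*} [CommSemiring S] [Fintype κ]
    [DecidableEq κ] (A : Matrix ι κ S) (d : κ → S) (B : Matrix κ μ S) (i : ι) (j : μ) :
    (A * Matrix.diagonal d * B) i j = ∑ k, A i k * d k * B k j := by
  rw [Matrix.mul_apply]
  exact Finset.sum_congr rfl fun k _ => by rw [Matrix.mul_diagonal]

theorem eval₂_genericProduct {F S : Type*} [Field F] [CommRing S] [Algebra F S] {n m : ℕ}
    (f : MvPolynomial (Fin n × Fin m) F)
    (φ : MvPolynomial ((Fin n × Fin n) ⊕ (Fin n × Fin m)) F →ₐ[F] S) (d : Fin n → S) :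
    MvPolynomial.eval₂ (φ : _ →+* S) d (genericProduct f) =
      MvPolynomial.aeval (fun x => ∑ k, φ (MvPolynomial.X (Sum.inl (x.1, k))) * d k *
        φ (MvPolynomial.X (Sum.inr (k, x.2)))) f := by
  refine (MvPolynomial.hom_eval₂ f _ (MvPolynomial.eval₂Hom φ.toRingHom d) _).trans ?_
  rw [MvPolynomial.aeval_def]
  congr 1
  · refine RingHom.ext fun c => (MvPolynomial.eval₂_C _ _ _).trans ?_
    exact φ.commutes c
  · funext x
    simp only [map_sum, map_mul, MvPolynomial.coe_eval₂Hom, MvPolynomial.eval₂_C,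
      MvPolynomial.eval₂_X, AlgHom.toRingHom_eq_coe, RingHom.coe_coe]
    exact Finset.sum_congr rfl fun k _ => by ring

/-- Specializing `A` to the identity, `d` to `1` and `B` to the generic matrix recovers `f`. -/
theorem genericProduct_ne_zero {F : Type*} [Field F] {n m : ℕ}
    {f : MvPolynomial (Fin n × Fin m) F} (hf : f ≠ 0) : genericProduct f ≠ 0 := by
  intro h
  have := eval₂_genericProduct f (MvPolynomial.aeval (Sum.elim
    (fun x => (1 : Matrix (Fin n) (Fin n) (MvPolynomial (Fin n × Fin m) F)) x.1 x.2)
    MvPolynomial.X)) 1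
  rw [h, MvPolynomial.eval₂_zero] at this
  simp only [MvPolynomial.aeval_X, Sum.elim_inl, Sum.elim_inr] at this
  apply hf
  rw [this]
  conv_lhs => rw [← MvPolynomial.aeval_X_left_apply f]
  congr 2
  funext x
  rw [Finset.sum_eq_single x.1]
  · simp
  · intro k _ hk
    rw [Matrix.one_apply_ne hk.symm, zero_mul, zero_mul]
  · simp

/-- Setting `d i = 0` off the support of `α` preserves the coefficient of `α`, but if fewer than `r`
variables survive, the matrix has rank below `r` and `f` vanishes. -/
theorem le_card_support_of_mem_support_genericProduct {F : Type*} [Field F] {n m r : ℕ}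
    {f : MvPolynomial (Fin n × Fin m) F} (hf : f ∈ detIdeal F n m r) {α : Fin n →₀ ℕ}
    (hα : α ∈ (genericProduct f).support) : r ≤ α.support.card := by
  classical
  by_contra! hlt
  let R := MvPolynomial ((Fin n × Fin n) ⊕ (Fin n × Fin m)) F
  let d : Fin n → MvPolynomial (Fin n) R := fun i =>
    if i ∈ α.support then MvPolynomial.X i else 0
  have h1 := eval₂_genericProduct f (IsScalarTower.toAlgHom F R (MvPolynomial (Fin n) R)) d
  have h0 := aeval_eq_zero_of_mem_detIdeal hf
    (Matrix.of fun i k => MvPolynomial.C (MvPolynomial.X (Sum.inl (i, k)) : R))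
    (Matrix.of fun k j => MvPolynomial.C (MvPolynomial.X (Sum.inr (k, j)) : R))
    d α.support hlt (fun i hi => if_neg hi)
  simp only [Matrix.mul_diagonal_mul_apply, Matrix.of_apply] at h0
  have h4 : ∀ c : R, (IsScalarTower.toAlgHom F R (MvPolynomial (Fin n) R)) c =
    MvPolynomial.C c := fun c => rfl
  simp only [h4, h0] at h1
  rw [MvPolynomial.eval₂_eq'] at h1
  simp only [RingHom.coe_coe, h4] at h1
  have h2 := congrArg (MvPolynomial.coeff α) h1
  rw [MvPolynomial.coeff_sum, Finset.sum_eq_single α] at h2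
  · have h3 : ∏ i, d i ^ α i = MvPolynomial.monomial α 1 := by
      rw [MvPolynomial.monomial_eq, Finsupp.prod_fintype _ _ (by simp), map_one, one_mul]
      refine Finset.prod_congr rfl fun i _ => ?_
      by_cases hi : i ∈ α.support
      · simp only [d, if_pos hi]
      · rw [Finsupp.notMem_support_iff.1 hi, pow_zero, pow_zero]
    rw [h3] at h2
    rw [MvPolynomial.coeff_C_mul, MvPolynomial.coeff_monomial, if_pos rfl, mul_one] at h2
    exact MvPolynomial.mem_support_iff.1 hα h2
  · intro β _ hβ
    rw [MvPolynomial.coeff_C_mul]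
    by_cases hs : ∀ i, i ∉ α.support → β i = 0
    · have h3 : ∏ i, d i ^ β i = MvPolynomial.monomial β 1 := by
        rw [MvPolynomial.monomial_eq, Finsupp.prod_fintype _ _ (by simp), map_one, one_mul]
        refine Finset.prod_congr rfl fun i _ => ?_
        by_cases hi : i ∈ α.support
        · simp only [d, if_pos hi]
        · rw [hs i hi, pow_zero, pow_zero]
      rw [h3, MvPolynomial.coeff_monomial, if_neg hβ, mul_zero]
    · push Not at hs
      obtain ⟨i, hi, hβi⟩ := hs
      rw [Finset.prod_eq_zero (Finset.mem_univ i) (by simp only [d, if_neg hi]; exact zero_pow hβi),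
        MvPolynomial.coeff_zero, mul_zero]
  · intro h
    exact absurd hα h

/-! ### Specialization to `F[ε]` and the dominant monomial. -/

/-- `F` may be finite, so a nonvanishing point is sought over the infinite domain `F[ε]`. -/
theorem MvPolynomial.exists_aeval_polynomial_ne_zero {F τ : Type*} [Field F]
    {c : MvPolynomial τ F} (hc : c ≠ 0) :
    ∃ θ : τ → Polynomial F, MvPolynomial.aeval θ c ≠ 0 := by
  by_contra! h
  refine hc (MvPolynomial.map_injective (Polynomial.C : F →+* _) Polynomial.C_injective ?_)
  rw [map_zero]
  refine MvPolynomial.funext fun θ => ?_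
  rw [map_zero, MvPolynomial.eval_map]
  exact h θ

/-- A nonzero power series is a power of `ε` times a unit; dividing by `c` therefore costs only `k`
powers of `ε`. -/
theorem Polynomial.exists_coe_mul_eq_X_pow {F : Type*} [Field F] {c : Polynomial F} (hc : c ≠ 0) :
    ∃ (k : ℕ) (v : F⟦X⟧), (c : F⟦X⟧) * v = PowerSeries.X ^ k := by
  have hc' : (c : F⟦X⟧) ≠ 0 := by simpa using hc
  refine ⟨(c : F⟦X⟧).order.toNat, ↑(PowerSeries.Unit_of_divided_by_X_pow_order (c : F⟦X⟧))⁻¹, ?_⟩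
  rw [Units.mul_inv_eq_iff_eq_mul, PowerSeries.Unit_of_divided_by_X_pow_order_nonzero hc',
    PowerSeries.X_pow_order_mul_divXPowOrder]

/-- Affine linear polynomials over `F⟦ε⟧` are close to affine linear polynomials over `F[ε]`. -/
theorem MvPolynomial.exists_affine_approx {F σ : Type*} [Field F] [Fintype σ]
    {P : MvPolynomial σ F⟦X⟧} (hP : P.totalDegree ≤ 1) (N : ℕ) :
    ∃ (c : Polynomial F) (a : σ → Polynomial F), MvPolynomial.C PowerSeries.X ^ N ∣
      P - (MvPolynomial.C (c : F⟦X⟧) +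
        ∑ i, MvPolynomial.C (a i : F⟦X⟧) * MvPolynomial.X i) := by
  have h : ∀ x : F⟦X⟧, ∃ y, x - (PowerSeries.trunc N x : F⟦X⟧) = PowerSeries.X ^ N * y := fun x =>
    PowerSeries.X_pow_dvd_iff.2 fun k hk => by
      simp [Polynomial.coeff_coe, PowerSeries.coeff_trunc, hk]
  choose y hy using h
  refine ⟨PowerSeries.trunc N (P.coeff 0), fun i => PowerSeries.trunc N (P.coeff (.single i 1)),
    MvPolynomial.C (y (P.coeff 0)) +
      ∑ i, MvPolynomial.C (y (P.coeff (.single i 1))) * MvPolynomial.X i, ?_⟩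
  refine (congrArg (· - _) (MvPolynomial.eq_of_totalDegree_le_one hP)).trans ?_
  beta_reduce
  rw [add_sub_add_comm, ← map_sub, hy, ← Finset.sum_sub_distrib, mul_add, Finset.mul_sum, map_mul,
    map_pow]
  congr 1
  refine Finset.sum_congr rfl fun i _ => ?_
  rw [← sub_mul, ← map_sub, hy, map_mul, map_pow, mul_assoc]

/-- At a point whose coordinates are suitable powers of `ε`, up to one unit, a polynomial is
dominated by its monomial of least weight. -/
theorem MvPolynomial.pow_dvd_eval₂_sub {R S : Type*} [CommRing R] [CommRing S] {n : ℕ}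
    (P : MvPolynomial (Fin n) R) (φ : R →+* S) (ε u γ : S) (p : Fin n) {b G M : ℕ} (hG : M ≤ G)
    (hb : 1 < b) (hP : ∀ α ∈ P.support, ∀ i, α i < b) {α₀ : Fin n →₀ ℕ} (hα₀ : α₀ ∈ P.support)
    (hmin : ∀ α ∈ P.support, ∑ i : Fin n, b ^ (i : ℕ) * α₀ i ≤ ∑ i : Fin n, b ^ (i : ℕ) * α i)
    (hγ : ε ^ M ∣ φ (P.coeff α₀) - γ) :
    ε ^ (2 * G * (∑ i : Fin n, b ^ (i : ℕ) * α₀ i) + M) ∣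
      MvPolynomial.eval₂ φ (fun i : Fin n => ε ^ (2 * (G * b ^ (i : ℕ))) * if i = p then u else 1) P
        - ε ^ (2 * G * (∑ i : Fin n, b ^ (i : ℕ) * α₀ i)) * γ * u ^ α₀ p := by
  have hprod : ∀ α : Fin n →₀ ℕ,
      ∏ i : Fin n, (ε ^ (2 * (G * b ^ (i : ℕ))) * if i = p then u else 1) ^ α i =
        ε ^ (2 * G * ∑ i : Fin n, b ^ (i : ℕ) * α i) * u ^ α p := by
    intro α
    simp only [mul_pow, Finset.prod_mul_distrib, ← pow_mul]
    congr 1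
    · rw [Finset.prod_pow_eq_pow_sum, Finset.mul_sum]
      congr 1
      exact Finset.sum_congr rfl fun i _ => by ring
    · rw [Finset.prod_eq_single p]
      · simp
      · intro i _ hi
        simp [hi]
      · simp
  rw [MvPolynomial.eval₂_eq', ← Finset.add_sum_erase _ _ hα₀, add_sub_right_comm]
  simp only [hprod]
  refine dvd_add ?_ (Finset.dvd_sum fun α hα => ?_)
  · obtain ⟨c, hc⟩ := hγ
    refine ⟨c * u ^ α₀ p, ?_⟩
    rw [pow_add]
    linear_combination ε ^ (2 * G * ∑ i : Fin n, b ^ (i : ℕ) * α₀ i) * u ^ α₀ p * hc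
  · obtain ⟨hne, hα⟩ := Finset.mem_erase.1 hα
    refine Dvd.dvd.mul_left (Dvd.dvd.mul_right (pow_dvd_pow _ ?_) _) _
    have h1 : ∑ i : Fin n, b ^ (i : ℕ) * α₀ i < ∑ i : Fin n, b ^ (i : ℕ) * α i :=
      lt_of_le_of_ne (hmin α hα) fun h => hne
        (DFunLike.coe_injective (sum_pow_mul_injective hb (hP α₀ hα₀) (hP α hα) h).symm)
    -- Another monomial has weight larger by at least `1`, hence gains `ε ^ (2 * G)`, and `M ≤ 2 *
    -- G`.
    calc _ ≤ 2 * G * (∑ i : Fin n, b ^ (i : ℕ) * α₀ i + 1) := by rw [mul_add, mul_one]; omega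
      _ ≤ _ := Nat.mul_le_mul_left _ h1

theorem Matrix.dvd_mul_sub_of_dvd_sub_one {S ι κ : Type*} [CommRing S] [Fintype κ] [DecidableEq κ]
    {c : S} (A : Matrix ι κ S) {L : Matrix κ κ S} (hL : ∀ i j, c ∣ L i j - (1 : Matrix κ κ S) i j)
    (i : ι) (j : κ) : c ∣ (A * L) i j - A i j := by
  have h : (A * L) i j - A i j = (A * (L - 1) : Matrix ι κ S) i j := by
    rw [Matrix.mul_sub, Matrix.mul_one, Matrix.sub_apply]
  rw [h, Matrix.mul_apply]
  exact Finset.dvd_sum fun k _ => Dvd.dvd.mul_left (hL k j) _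

theorem Matrix.dvd_mul_sub_of_dvd_sub_one' {S ι κ : Type*} [CommRing S] [Fintype κ] [DecidableEq κ]
    {c : S} (A : Matrix κ ι S) {L : Matrix κ κ S} (hL : ∀ i j, c ∣ L i j - (1 : Matrix κ κ S) i j)
    (i : κ) (j : ι) : c ∣ (L * A) i j - A i j := by
  have h : (L * A) i j - A i j = ((L - 1) * A : Matrix κ ι S) i j := by
    rw [Matrix.sub_mul, Matrix.one_mul, Matrix.sub_apply]
  rw [h, Matrix.mul_apply]
  exact Finset.dvd_sum fun k _ => Dvd.dvd.mul_right (hL i k) _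

/-- The embedding of `F[ε]` into `F⟦ε⟧[y]`. -/
noncomputable def polynomialToMvPowerSeriesCoeff (F σ : Type*) [Field F] :
    Polynomial F →ₐ[F] MvPolynomial σ F⟦X⟧ :=
  { (MvPolynomial.C : F⟦X⟧ →+* MvPolynomial σ F⟦X⟧).comp Polynomial.coeToPowerSeries.ringHom with
    commutes' := fun c => by
      simp [MvPolynomial.algebraMap_apply] }

theorem isApprox_iff_dvd {F σ : Type*} [Field F] {H : MvPolynomial σ F⟦X⟧} {f : MvPolynomial σ F} :
    IsApprox H f ↔ MvPolynomial.C PowerSeries.X ∣ H - MvPolynomial.map (PowerSeries.C (R := F)) f :=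
  exists_congr fun _ => by rw [sub_eq_iff_eq_add']

/-- The oracle `h(X, ε ^ N)` agrees with `f` up to order `N`. -/
theorem pow_dvd_aeval_substEpsPow_sub {F σ κ : Type*} [Field F] {f : MvPolynomial κ F}
    {h : MvPolynomial κ F⟦X⟧} (hh : IsApprox h f) {N : ℕ} (hN : N ≠ 0)
    (W : κ → MvPolynomial σ F⟦X⟧) :
    MvPolynomial.C PowerSeries.X ^ N ∣
      MvPolynomial.aeval W (substEpsPow N hN h) - MvPolynomial.aeval W f := by
  obtain ⟨e, rfl⟩ := hh
  have h1 : MvPolynomial.map (PowerSeries.expand N hN : F⟦X⟧ →ₐ[F] F⟦X⟧).toRingHom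
      (MvPolynomial.map (PowerSeries.C (R := F)) f) =
        MvPolynomial.map (algebraMap F F⟦X⟧) f := by
    rw [MvPolynomial.map_map]
    congr 1
    refine congrArg _ (RingHom.ext fun c => ?_)
    exact PowerSeries.expand_C N hN c
  have h2 : (PowerSeries.expand N hN : F⟦X⟧ →ₐ[F] F⟦X⟧).toRingHom PowerSeries.X =
      PowerSeries.X ^ N := PowerSeries.expand_X N hN
  rw [substEpsPow, map_add, map_mul, h1, MvPolynomial.map_C, h2, map_add, map_mul,
    MvPolynomial.aeval_map_algebraMap, add_sub_cancel_left, MvPolynomial.aeval_C,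
    MvPolynomial.algebraMap_eq, map_pow]
  exact dvd_mul_right _ _

theorem aeval_mul_diagonal_mul {F S : Type*} [Field F] [CommRing S] [Algebra F S] {n m : ℕ}
    (f : MvPolynomial (Fin n × Fin m) F) (A : Matrix (Fin n) (Fin n) S) (d : Fin n → S)
    (B : Matrix (Fin n) (Fin m) S) :
    MvPolynomial.aeval (fun x => (A * Matrix.diagonal d * B) x.1 x.2) f =
      MvPolynomial.eval₂ (MvPolynomial.aeval (R := F)
        (Sum.elim (fun x : Fin n × Fin n => A x.1 x.2) fun x : Fin n × Fin m => B x.1 x.2)).toRingHom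
        d (genericProduct f) := by
  refine Eq.trans ?_ (eval₂_genericProduct f (MvPolynomial.aeval (Sum.elim
    (fun x : Fin n × Fin n => A x.1 x.2) fun x : Fin n × Fin m => B x.1 x.2)) d).symm
  refine congrArg (fun w => MvPolynomial.aeval w f) (funext fun x => ?_)
  simp only [Matrix.mul_diagonal_mul_apply, MvPolynomial.aeval_X, Sum.elim_inl, Sum.elim_inr]

/-! ### The affine substitution. -/

/-- An oracle for `h(X, ε ^ N)`, evaluated at suitable affine linear forms over `F[ε]`, computes a
power of `g` up to an affine function and `O(ε)`. -/
theorem exists_affine_substitution {F : Type*} [Field F] {n m r l : ℕ}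
    {f : MvPolynomial (Fin n × Fin m) F} (hf : f ∈ detIdeal F n m r) (hf0 : f ≠ 0)
    {h : MvPolynomial (Fin n × Fin m) F⟦X⟧} (hh : IsApprox h f)
    {g : MvPolynomial (Fin l) F} (hg : g ∈ borderABP F (Fin l) r) (q : ℕ) [ExpChar F q] :
    ∃ (N : ℕ) (hN : N ≠ 0) (c : Fin n × Fin m → Polynomial F)
      (d : Fin n × Fin m → Fin l → Polynomial F) (a : ℕ) (γ β : Polynomial F)
      (H : MvPolynomial (Fin l) F⟦X⟧), β ≠ 0 ∧ IsApprox H (g ^ q ^ a) ∧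
      MvPolynomial.aeval (fun x => MvPolynomial.C (c x : F⟦X⟧) +
          ∑ i, MvPolynomial.C (d x i : F⟦X⟧) * MvPolynomial.X i) (substEpsPow N hN h) =
        MvPolynomial.C (γ : F⟦X⟧) + MvPolynomial.C (β : F⟦X⟧) * H := by
  classical
  obtain ⟨s, hsr, B, g', hB, hg'⟩ := hg
  set P := genericProduct f with hP
  have hP0 : P.support.Nonempty := MvPolynomial.support_nonempty.2 (genericProduct_ne_zero hf0)
  let b := 2 + P.support.sup fun α => Finset.univ.sup fun i => α i
  have hb : ∀ α ∈ P.support, ∀ i, α i < b := by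
    intro α hα i
    have h1 : α i ≤ Finset.univ.sup fun i => α i :=
      Finset.le_sup (f := fun i => α i) (Finset.mem_univ i)
    have h2 := Finset.le_sup (f := fun α : Fin n →₀ ℕ => Finset.univ.sup fun i => α i) hα
    simp only [b]
    omega
  obtain ⟨α₀, hα₀, hmin⟩ := Finset.exists_min_image P.support
    (fun α => ∑ i : Fin n, b ^ (i : ℕ) * α i) hP0
  have hcard := le_card_support_of_mem_support_genericProduct hf hα₀
  have hs : 0 < s := B.sink.pos
  have hne : α₀.support.Nonempty := Finset.card_pos.1 (by omega)
  -- The support has at least `r ≥ s` elements, all at most `p`, so the program fits; membership of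
  -- `p` makes the exponent of `1 + ε * g'` nonzero.
  let p := α₀.support.max' hne
  have hp : s ≤ p + 1 := by
    have h1 : α₀.support ⊆ Finset.Iic p := fun i hi => Finset.mem_Iic.2 (Finset.le_max' _ _ hi)
    have h2 := Finset.card_le_card h1
    rw [Fin.card_Iic] at h2
    omega
  have hk : α₀ p ≠ 0 := Finsupp.mem_support_iff.1 (Finset.max'_mem _ hne)
  obtain ⟨a, k', hk', hpow⟩ :=
    exists_one_add_pow_eq (F := F) (S := MvPolynomial (Fin l) F⟦X⟧) q hk
  obtain ⟨θ₀, hθ₀⟩ := MvPolynomial.exists_aeval_polynomial_ne_zero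
    (MvPolynomial.mem_support_iff.1 hα₀)
  set γ₀ := MvPolynomial.aeval θ₀ (P.coeff α₀) with hγ₀
  obtain ⟨q₀, v, hv⟩ := Polynomial.exists_coe_mul_eq_X_pow hθ₀
  obtain ⟨A, src, w, hA, hAdeg, hwA, hwp, hw⟩ := B.exists_strictly_upper p hp
  -- The final division removes `ε ^ q ^ a` and, through `γ₀`, another `ε ^ q₀`; the last `1` leaves
  -- the error in `O(ε)`.
  let M := q₀ + q ^ a + 1
  obtain ⟨G, hG, L, U, V, hL, hU, hV, hVdeg⟩ := exists_affine_factorization (show 2 ≤ b by omega)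
    A p src w hA hAdeg hwA hw g' (by rw [hwp, hB]) M
  set ε : MvPolynomial (Fin l) F⟦X⟧ := MvPolynomial.C PowerSeries.X with hε
  obtain ⟨κ, hκ⟩ : ∃ κ : Polynomial F →ₐ[F] MvPolynomial (Fin l) F⟦X⟧,
      ∀ x, κ x = MvPolynomial.C (x : F⟦X⟧) := ⟨polynomialToMvPowerSeriesCoeff F _, fun _ => rfl⟩
  let A₀ : Matrix (Fin n) (Fin n) (MvPolynomial (Fin l) F⟦X⟧) :=
    Matrix.of fun i k => κ (θ₀ (Sum.inl (i, k)))
  let B₀ : Matrix (Fin n) (Fin m) (MvPolynomial (Fin l) F⟦X⟧) :=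
    Matrix.of fun k j => κ (θ₀ (Sum.inr (k, j)))
  let θ : (Fin n × Fin n) ⊕ (Fin n × Fin m) → MvPolynomial (Fin l) F⟦X⟧ :=
    Sum.elim (fun x => (A₀ * L) x.1 x.2) (fun x => (U * B₀) x.1 x.2)
  let E : Fin n → MvPolynomial (Fin l) F⟦X⟧ :=
    fun i => ε ^ (2 * (G * b ^ (i : ℕ))) * if i = p then 1 + ε * g' else 1
  let W := A₀ * V * B₀
  let wt := 2 * G * ∑ i : Fin n, b ^ (i : ℕ) * α₀ i
  have hWdeg : ∀ i j, (W i j).totalDegree ≤ 1 := by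
    intro i j
    simp only [W, Matrix.mul_apply]
    refine MvPolynomial.totalDegree_finsetSum_le fun k _ => ?_
    refine (MvPolynomial.totalDegree_mul _ _).trans ?_
    have h1 : (B₀ k j).totalDegree = 0 := by
      simp only [B₀, Matrix.of_apply, hκ, MvPolynomial.totalDegree_C]
    rw [h1, add_zero]
    refine MvPolynomial.totalDegree_finsetSum_le fun k' _ => ?_
    refine (MvPolynomial.totalDegree_mul _ _).trans ?_
    have h2 : (A₀ i k').totalDegree = 0 := by
      simp only [A₀, Matrix.of_apply, hκ, MvPolynomial.totalDegree_C]
    rw [h2, zero_add]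
    exact hVdeg _ _
  have hfW : MvPolynomial.aeval (fun x => W x.1 x.2) f =
      MvPolynomial.eval₂ (MvPolynomial.aeval θ : _ →ₐ[F] _).toRingHom E P := by
    have h1 : W = A₀ * L * Matrix.diagonal E * (U * B₀) := by
      simp only [W, hV, Matrix.mul_assoc, E]
    rw [h1]
    exact aeval_mul_diagonal_mul f (A₀ * L) E (U * B₀)
  have hθ : ε ^ M ∣ (MvPolynomial.aeval θ : _ →ₐ[F] _).toRingHom (P.coeff α₀) - κ γ₀ := by
    have h1 : κ γ₀ = MvPolynomial.eval₂ (algebraMap F _) (fun i => κ (θ₀ i)) (P.coeff α₀) := by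
      rw [hγ₀, ← MvPolynomial.aeval_def, ← AlgHom.comp_apply, MvPolynomial.comp_aeval]
    rw [h1, ← Ideal.mem_span_singleton]
    refine MvPolynomial.eval₂_sub_eval₂_mem _ _ (fun i => ?_) _
    rw [Ideal.mem_span_singleton]
    rcases i with x | x
    · exact Matrix.dvd_mul_sub_of_dvd_sub_one A₀ hL x.1 x.2
    · exact Matrix.dvd_mul_sub_of_dvd_sub_one' B₀ hU x.1 x.2
  have hmain : ε ^ (wt + M) ∣ MvPolynomial.aeval (fun x => W x.1 x.2) f -
      ε ^ wt * κ γ₀ * (1 + ε * g') ^ α₀ p := by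
    rw [hfW]
    exact P.pow_dvd_eval₂_sub _ ε (1 + ε * g') (κ γ₀) p hG (by omega) hb hα₀ hmin hθ
  have hN : wt + M ≠ 0 := by omega
  choose c d hcd using fun x : Fin n × Fin m =>
    MvPolynomial.exists_affine_approx (hWdeg x.1 x.2) (wt + M)
  let W' : Fin n × Fin m → MvPolynomial (Fin l) F⟦X⟧ := fun x => MvPolynomial.C (c x : F⟦X⟧) +
    ∑ i, MvPolynomial.C (d x i : F⟦X⟧) * MvPolynomial.X i
  have h1 : ε ^ (wt + M) ∣ MvPolynomial.aeval (fun x => W x.1 x.2) (substEpsPow (wt + M) hN h) -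
      MvPolynomial.aeval W' (substEpsPow (wt + M) hN h) := by
    rw [← Ideal.mem_span_singleton]
    exact MvPolynomial.eval₂_sub_eval₂_mem _ _
      (fun x => Ideal.mem_span_singleton.2 (hcd x)) _
  have h2 := pow_dvd_aeval_substEpsPow_sub hh hN (fun x => W x.1 x.2)
  obtain ⟨e, he⟩ : ε ^ (wt + M) ∣ MvPolynomial.aeval W' (substEpsPow (wt + M) hN h) -
      ε ^ wt * κ γ₀ * (1 + ε * g') ^ α₀ p := by
    have := dvd_add (dvd_sub h2 h1) hmain
    convert this using 1
    ring
  obtain ⟨z, hz⟩ := hpow (ε * g')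
  -- Division by `β` includes division by `k'`, which is nonzero in `F`.
  let kinv : MvPolynomial (Fin l) F⟦X⟧ := algebraMap F _ (k' : F)⁻¹
  have hkinv : (k' : MvPolynomial (Fin l) F⟦X⟧) * kinv = 1 := by
    simp only [kinv]
    rw [← map_natCast (algebraMap F (MvPolynomial (Fin l) F⟦X⟧)), ← map_mul, mul_inv_cancel₀ hk',
      map_one]
  have hQ : 1 ≤ q ^ a := Nat.one_le_pow _ _ (expChar_pos F q)
  -- The constants are the first two coefficients of `ε ^ wt * γ₀ * (1 + k' * (ε * g') ^ q ^ a +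
  -- …)`; the remaining terms and the error, divided by the second one, are multiples of `ε`.
  refine ⟨wt + M, hN, c, d, a, Polynomial.X ^ wt * γ₀,
    Polynomial.X ^ (wt + q ^ a) * γ₀ * (k' : Polynomial F),
    g' ^ q ^ a + kinv * (ε ^ q ^ a * g' ^ (2 * q ^ a) * z + ε * MvPolynomial.C v * e), ?_, ?_, ?_⟩
  · have : (k' : Polynomial F) ≠ 0 := by
      have := Polynomial.C_ne_zero.2 hk'
      rwa [map_natCast] at this
    exact mul_ne_zero (mul_ne_zero (pow_ne_zero _ Polynomial.X_ne_zero) hθ₀) this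
  · rw [isApprox_iff_dvd] at hg' ⊢
    rw [add_sub_right_comm, map_pow]
    refine dvd_add (hg'.trans (sub_dvd_pow_sub_pow _ _ _)) (Dvd.dvd.mul_left (dvd_add ?_ ?_) _)
    · exact ((dvd_pow_self ε (by omega)).mul_right _).mul_right _
    · exact (dvd_mul_right _ _).mul_right _
  · refine (sub_eq_iff_eq_add.1 he).trans ?_
    rw [← hκ (Polynomial.X ^ wt * γ₀),
      ← hκ (Polynomial.X ^ (wt + q ^ a) * γ₀ * (k' : Polynomial F)), hz]
    have hκX : κ Polynomial.X = ε := by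
      rw [hκ, Polynomial.coe_X]
    have hκv : κ γ₀ * MvPolynomial.C v = ε ^ q₀ := by
      rw [hκ, ← map_mul, hv, map_pow]
    simp only [map_mul, map_pow, hκX, map_natCast]
    have hM : ε ^ (wt + M) = ε ^ (wt + q ^ a + 1) * (κ γ₀ * MvPolynomial.C v) := by
      rw [hκv, ← pow_add]
      congr 1
      simp only [M]
      omega
    rw [hM, mul_pow, mul_pow]
    simp only [pow_add, two_mul, pow_one]
    linear_combination (-(ε ^ wt * ε ^ q ^ a * κ γ₀ *
      (ε ^ q ^ a * (g' ^ q ^ a * g' ^ q ^ a) * z + ε * MvPolynomial.C v * e))) * hkinv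

/-! ### The depth-three circuit. -/

namespace OracleCircuit

/-- The gates of a circuit with `b` affine linear forms in the variables, an oracle gate that reads
them through `e`, and an affine function of its value. -/
def sumOracleSumGate {K σ κ : Type*} [Fintype σ] {b : ℕ} (e : κ → Fin b) (c : Fin b → K)
    (d : Fin b → σ → K) (c' d' : K) (i : Fin (b + 2)) : OracleGate K κ (σ ⊕ Fin (i : ℕ)) :=
  if h : (i : ℕ) < b then
    .add (c ⟨i, h⟩) (Finset.univ.map Function.Embedding.inl)
      (Sum.elim (d ⟨i, h⟩) fun _ => c')
  else if h' : (i : ℕ) = b then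
    .oracle fun x => Sum.inr ⟨e x, by have := (e x).2; omega⟩
  else
    .add c' {Sum.inr ⟨b, by omega⟩} fun _ => d'

/-- The circuit with the gates `sumOracleSumGate`. -/
def sumOracleSum {K σ κ : Type*} [Fintype σ] {b : ℕ} (e : κ → Fin b) (c : Fin b → K)
    (d : Fin b → σ → K) (c' d' : K) : OracleCircuit K σ κ where
  size := b + 2
  gate := sumOracleSumGate e c d c' d'
  output := Fin.last (b + 1)

variable {K σ κ : Type*} [Fintype σ] {b : ℕ} (e : κ → Fin b) (c : Fin b → K)
    (d : Fin b → σ → K) (c' d' : K)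

theorem sumOracleSum_size : (sumOracleSum e c d c' d').size = b + 2 := rfl

theorem lt_sumOracleSum_size {i : ℕ} (h : i < b + 2) : i < (sumOracleSum e c d c' d').size := by
  rwa [sumOracleSum_size]

theorem sumOracleSum_gate_bottom (i : Fin (sumOracleSum e c d c' d').size) (h : (i : ℕ) < b) :
    (sumOracleSum e c d c' d').gate i = .add (c ⟨i, h⟩) (Finset.univ.map Function.Embedding.inl)
      (Sum.elim (d ⟨i, h⟩) fun _ => c') := by
  simp only [sumOracleSum, sumOracleSumGate, dif_pos h]

theorem sumOracleSum_gate_oracle (i : Fin (sumOracleSum e c d c' d').size) (h : (i : ℕ) = b) :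
    (sumOracleSum e c d c' d').gate i =
      .oracle fun x => Sum.inr ⟨e x, by have := (e x).2; omega⟩ := by
  simp only [sumOracleSum, sumOracleSumGate, dif_neg h.not_lt, dif_pos h]

theorem sumOracleSum_gate_output (i : Fin (sumOracleSum e c d c' d').size) (h : (i : ℕ) = b + 1) :
    (sumOracleSum e c d c' d').gate i = .add c' {Sum.inr ⟨b, by omega⟩} fun _ => d' := by
  simp only [sumOracleSum, sumOracleSumGate]
  rw [dif_neg (by omega), dif_neg (by omega)]

section Level

variable [Fintype κ]

theorem sumOracleSum_gateLevel_bottom (i : Fin (sumOracleSum e c d c' d').size) (h : (i : ℕ) < b) :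
    (sumOracleSum e c d c' d').gateLevel i = 1 := by
  rw [gateLevel, sumOracleSum_gate_bottom e c d c' d' i h]
  simp only [OracleGate.level, Finset.sup_map, Nat.add_eq_right]
  exact Nat.le_zero.1 (Finset.sup_le fun _ _ => le_rfl)

/-- `Nonempty κ` matters: an oracle gate without inputs would have level `1`. -/
theorem sumOracleSum_gateLevel_oracle [Nonempty κ] (i : Fin (sumOracleSum e c d c' d').size)
    (h : (i : ℕ) = b) : (sumOracleSum e c d c' d').gateLevel i = 2 := by
  rw [gateLevel, sumOracleSum_gate_oracle e c d c' d' i h]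
  simp only [OracleGate.level, Sum.elim_inr]
  rw [Finset.sup_congr rfl fun x _ =>
    sumOracleSum_gateLevel_bottom e c d c' d'
      ⟨e x, lt_sumOracleSum_size e c d c' d' (by omega)⟩ (e x).2,
    Finset.sup_const Finset.univ_nonempty]

theorem sumOracleSum_gateLevel_output [Nonempty κ] (i : Fin (sumOracleSum e c d c' d').size)
    (h : (i : ℕ) = b + 1) : (sumOracleSum e c d c' d').gateLevel i = 3 := by
  rw [gateLevel, sumOracleSum_gate_output e c d c' d' i h]
  simp only [OracleGate.level, Finset.sup_singleton, Sum.elim_inr]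
  rw [sumOracleSum_gateLevel_oracle e c d c' d' ⟨b, lt_sumOracleSum_size e c d c' d' (by omega)⟩ rfl]

theorem sumOracleSum_isSumOracleSum [Nonempty κ] :
    (sumOracleSum e c d c' d').IsSumOracleSum b := by
  have hlt : ∀ i : Fin (sumOracleSum e c d c' d').size, (i : ℕ) < b + 2 := fun i => i.2
  have hcases : ∀ i : Fin (sumOracleSum e c d c' d').size,
      (i : ℕ) < b ∨ (i : ℕ) = b ∨ (i : ℕ) = b + 1 := fun i => by have := hlt i; omega
  refine ⟨?_, sumOracleSum_gateLevel_output e c d c' d' _ rfl, rfl, ?_, ?_, ?_⟩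
  · intro i w hw
    rcases hcases i with h | h | h
    · rw [sumOracleSum_gate_bottom e c d c' d' i h] at hw
      rw [sumOracleSum_gateLevel_bottom e c d c' d' i h]
      simp only [OracleGate.inputs, Finset.mem_map, Finset.mem_univ, true_and,
        Set.mem_ofPred_eq] at hw
      obtain ⟨x, rfl⟩ := hw
      rfl
    · rw [sumOracleSum_gate_oracle e c d c' d' i h] at hw
      rw [sumOracleSum_gateLevel_oracle e c d c' d' i h]
      obtain ⟨x, rfl⟩ := hw
      exact congrArg (· + 1) (sumOracleSum_gateLevel_bottom e c d c' d' _ (e x).2)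
    · rw [sumOracleSum_gate_output e c d c' d' i h] at hw
      rw [sumOracleSum_gateLevel_output e c d c' d' i h]
      simp only [OracleGate.inputs, Finset.mem_singleton, Set.ofPred_eq_eq_singleton,
        Set.mem_singleton_iff] at hw
      subst hw
      exact congrArg (· + 1) (sumOracleSum_gateLevel_oracle e c d c' d'
        ⟨b, lt_sumOracleSum_size e c d c' d' (by omega)⟩ rfl)
  · have : (sumOracleSum e c d c' d').addGates 1 =
        Set.range (fun i : Fin b => (⟨i, lt_sumOracleSum_size e c d c' d' (by omega)⟩ :
          Fin (sumOracleSum e c d c' d').size)) := by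
      ext i
      constructor
      · rintro ⟨_, hi⟩
        rcases hcases i with h | h | h
        · exact ⟨⟨i, h⟩, rfl⟩
        · rw [sumOracleSum_gateLevel_oracle e c d c' d' i h] at hi
          omega
        · rw [sumOracleSum_gateLevel_output e c d c' d' i h] at hi
          omega
      · rintro ⟨j, rfl⟩
        refine ⟨?_, sumOracleSum_gateLevel_bottom e c d c' d' _ j.2⟩
        rw [sumOracleSum_gate_bottom e c d c' d' _ j.2]
        trivial
    rw [this, ← Set.image_univ, Set.ncard_image_of_injective _ fun i j hij => by
      simpa [Fin.ext_iff] using hij]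
    simp
  · rw [Set.ncard_eq_one]
    refine ⟨(⟨b, lt_sumOracleSum_size e c d c' d' (by omega)⟩ :
      Fin (sumOracleSum e c d c' d').size), Set.ext fun i => ⟨?_, ?_⟩⟩
    · rintro ⟨_, hi⟩
      rcases hcases i with h | h | h
      · rw [sumOracleSum_gateLevel_bottom e c d c' d' i h] at hi
        omega
      · exact Fin.ext h
      · rw [sumOracleSum_gateLevel_output e c d c' d' i h] at hi
        omega
    · rintro rfl
      refine ⟨?_, sumOracleSum_gateLevel_oracle e c d c' d' _ rfl⟩
      rw [sumOracleSum_gate_oracle e c d c' d' _ rfl]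
      trivial
  · rw [Set.ncard_eq_one]
    refine ⟨(⟨b + 1, lt_sumOracleSum_size e c d c' d' (by omega)⟩ :
      Fin (sumOracleSum e c d c' d').size), Set.ext fun i => ⟨?_, ?_⟩⟩
    · rintro ⟨_, hi⟩
      rcases hcases i with h | h | h
      · rw [sumOracleSum_gateLevel_bottom e c d c' d' i h] at hi
        omega
      · rw [sumOracleSum_gateLevel_oracle e c d c' d' i h] at hi
        omega
      · exact Fin.ext h
    · rintro rfl
      refine ⟨?_, sumOracleSum_gateLevel_output e c d c' d' _ rfl⟩
      rw [sumOracleSum_gate_output e c d c' d' _ rfl]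
      trivial

end Level

theorem sumOracleSum_poly {L : Type*} [Field K] [Field L] [Algebra K L] (h : MvPolynomial κ L) :
    (sumOracleSum e c d c' d').poly h =
      MvPolynomial.C (algebraMap K L c') + MvPolynomial.C (algebraMap K L d') *
        MvPolynomial.bind₁ (fun x => MvPolynomial.C (algebraMap K L (c (e x))) +
          ∑ y, MvPolynomial.C (algebraMap K L (d (e x) y)) * MvPolynomial.X y) h := by
  have h1 : ∀ i : Fin b, (sumOracleSum e c d c' d').gateValue h ⟨i,
      lt_sumOracleSum_size e c d c' d' (by omega)⟩ = MvPolynomial.C (algebraMap K L (c i)) +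
        ∑ y, MvPolynomial.C (algebraMap K L (d i y)) * MvPolynomial.X y := by
    intro i
    rw [gateValue, sumOracleSum_gate_bottom e c d c' d' _ i.2]
    simp [OracleGate.value]
  have h2 : (sumOracleSum e c d c' d').gateValue h (⟨b, lt_sumOracleSum_size e c d c' d' (by omega)⟩ :
      Fin (sumOracleSum e c d c' d').size) =
      MvPolynomial.bind₁ (fun x => MvPolynomial.C (algebraMap K L (c (e x))) +
          ∑ y, MvPolynomial.C (algebraMap K L (d (e x) y)) * MvPolynomial.X y) h := by
    rw [gateValue, sumOracleSum_gate_oracle e c d c' d' _ rfl]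
    simp only [OracleGate.value, Sum.elim_inr]
    exact congrArg (fun w => MvPolynomial.bind₁ w h) (funext fun x => h1 (e x))
  rw [poly, gateValue, sumOracleSum_gate_output e c d c' d' _ rfl]
  simp only [OracleGate.value, Sum.elim_inr, Finset.sum_singleton]
  rw [h2]

end OracleCircuit

/-! ### The main theorem. -/

theorem mainTheorem1 {F : Type*} [Field F] (n m r l : ℕ)
    (f : MvPolynomial (Fin n × Fin m) F) (hf : f ∈ detIdeal F n m r) (hf0 : f ≠ 0)
    (h : MvPolynomial (Fin n × Fin m) F⟦X⟧) (hh : IsApprox h f)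
    (g : MvPolynomial (Fin l) F) (hg : g ∈ borderABP F (Fin l) r) :
    ∃ (N : ℕ) (hN : N ≠ 0) (Φ : OracleCircuit (RatFunc F) (Fin l) (Fin n × Fin m)),
      Φ.IsSumOracleSum (n * m) ∧
      (CharZero F →
        BorderComputes
          (Φ.poly (MvPolynomial.map (HahnSeries.ofPowerSeries ℤ F) (substEpsPow N hN h))) g) ∧
      (∀ p : ℕ, 0 < p → CharP F p → ∃ k : ℕ,
        BorderComputes
          (Φ.poly (MvPolynomial.map (HahnSeries.ofPowerSeries ℤ F) (substEpsPow N hN h)))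
          (g ^ p ^ k)) := by
  obtain ⟨q, hq⟩ := ExpChar.exists F
  obtain ⟨N, hN, c, d, a, γ, β, H, hβ, hH, heq⟩ := exists_affine_substitution hf hf0 hh hg q
  -- A program has a sink, so `r ≥ 1`; an empty matrix then has no `r × r` minors and the ideal
  -- would be zero.
  have hne : Nonempty (Fin n × Fin m) := by
    obtain ⟨s, hsr, B, -⟩ := hg
    have hs : 0 < s := B.sink.pos
    by_contra hemp
    rw [not_nonempty_iff, isEmpty_prod] at hemp
    refine hf0 ?_
    have hbot : detIdeal F n m r = ⊥ := by
      refine Ideal.span_eq_bot.2 ?_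
      rintro _ ⟨R, C, rfl⟩
      rcases hemp with hemp | hemp
      · exact (hemp.false (R ⟨0, by omega⟩)).elim
      · exact (hemp.false (C ⟨0, by omega⟩)).elim
    rwa [hbot, Ideal.mem_bot] at hf
  let ρ : Polynomial F → RatFunc F := algebraMap (Polynomial F) (RatFunc F)
  have hρ : ∀ x : Polynomial F, algebraMap (RatFunc F) F⸨X⸩ (ρ x) =
      HahnSeries.ofPowerSeries ℤ F (x : F⟦X⟧) := fun x => (RatFunc.coe_coe x).symm
  let e : Fin n × Fin m ≃ Fin (n * m) := finProdFinEquiv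
  -- The output gate inverts `γ + β H`; this division by `β` is the only place where constants
  -- outside `F[ε]` occur.
  let Φ : OracleCircuit (RatFunc F) (Fin l) (Fin n × Fin m) :=
    OracleCircuit.sumOracleSum e (fun i => ρ (c (e.symm i))) (fun i y => ρ (d (e.symm i) y))
      (-(ρ β)⁻¹ * ρ γ) (ρ β)⁻¹
  have hΦ : Φ.poly (MvPolynomial.map (HahnSeries.ofPowerSeries ℤ F) (substEpsPow N hN h)) =
      MvPolynomial.map (HahnSeries.ofPowerSeries ℤ F) H := by
    have h1 := congrArg (MvPolynomial.map (HahnSeries.ofPowerSeries ℤ F)) heq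
    rw [OracleCircuit.sumOracleSum_poly]
    simp only [Equiv.symm_apply_apply, map_mul, map_neg, map_inv₀, hρ]
    have h2 : MvPolynomial.bind₁ (fun x : Fin n × Fin m =>
        MvPolynomial.C (HahnSeries.ofPowerSeries ℤ F (c x : F⟦X⟧)) +
          ∑ y, MvPolynomial.C (HahnSeries.ofPowerSeries ℤ F (d x y : F⟦X⟧)) * MvPolynomial.X y)
        (MvPolynomial.map (HahnSeries.ofPowerSeries ℤ F) (substEpsPow N hN h)) =
        MvPolynomial.map (HahnSeries.ofPowerSeries ℤ F) (MvPolynomial.aeval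
          (fun x => MvPolynomial.C (c x : F⟦X⟧) +
          ∑ i, MvPolynomial.C (d x i : F⟦X⟧) * MvPolynomial.X i) (substEpsPow N hN h)) := by
      rw [← MvPolynomial.bind₁, MvPolynomial.map_bind₁]
      simp only [map_add, map_sum, map_mul, MvPolynomial.map_C, MvPolynomial.map_X]
    rw [h2, h1, map_add, map_mul, MvPolynomial.map_C, MvPolynomial.map_C]
    have h3 : HahnSeries.ofPowerSeries ℤ F (β : F⟦X⟧) ≠ 0 := by
      rw [Ne, map_eq_zero_iff _ HahnSeries.ofPowerSeries_injective]
      simpa using hβ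
    have h4 : (MvPolynomial.C (HahnSeries.ofPowerSeries ℤ F (β : F⟦X⟧))⁻¹ :
        MvPolynomial (Fin l) F⸨X⸩) *
        MvPolynomial.C (HahnSeries.ofPowerSeries ℤ F (β : F⟦X⟧)) = 1 := by
      rw [← map_mul, inv_mul_cancel₀ h3, map_one]
    linear_combination (MvPolynomial.map (HahnSeries.ofPowerSeries ℤ F) H) * h4
  refine ⟨N, hN, Φ, OracleCircuit.sumOracleSum_isSumOracleSum _ _ _ _ _, fun hchar => ?_,
    fun p hp hchar => ⟨a, ?_⟩⟩
  · have hq1 : q = 1 := ExpChar.eq hq inferInstance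
    rw [hq1, one_pow, pow_one] at hH
    exact ⟨H, hΦ, hH⟩
  · have : NeZero p := ⟨hp.ne'⟩
    have : Fact p.Prime := ⟨CharP.char_is_prime_of_pos F p |>.out⟩
    have hqp : q = p := ExpChar.eq hq inferInstance
    rw [hqp] at hH
    exact ⟨H, hΦ, hH⟩
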